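/- Let $k$ be a field, let $\Phi$ be a totally ordered abelian group, and let $\Gamma\subset\Phi$ be a subsemigroup containing $0$ that is well ordered for the induced order. Let $(\gamma_i)_{i\in I}$ be a family of generators of $\Gamma$ (for example its minimal system of generators). Take variables $(u_i)_{i\in I}$ and give the monomial $u^m=\prod_i u_i^{m_i}$ (where $m_i\in\mathbf N$ and almost all $m_i$ are $0$) the weight $\sum_i m_i\gamma_i$. Suppose that $\Gamma$ is combinatorially finite with respect to these generators: for every $\phi$ there are only finitely many monomials of weight $\phi$. Let $\widehat{k[(u_i)_{i\in I}]}$ be the $k$-algebra of all sums $\sum_{e\in E}d_eu^e$, where $E$ is any set of monomials in the $u_i$ and $d_e\in k$, with the usual multiplication of series. Then $\widehat{k[(u_i)_{i\in I}]}$ is a henselian local ring: it is local, and for every monic polynomial $f$ over it and every element $a_0$ such that $f(a_0)$ lies in the maximal ideal $\hat m$ and $f'(a_0)$ is a unit, there is a root $a$ of $f$ with $a-a_0\in\hat m$. -/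

import Mathlib

/-- The weight `∑ i, m i • γ i` of the monomial `u ^ m = ∏ i, u i ^ m i`, where the variable `u i`
has weight `γ i`. -/
def monomialWeight {I Φ : Type*} [AddCommGroup Φ] (γ : I → Φ) (m : I →₀ ℕ) : Φ :=
  m.sum fun i n => n • γ i

/-- Combinatorial finiteness of the semigroup generated by the `γ i`, with respect to these
generators: there are only finitely many monomials of any given weight. -/
def CombinatoriallyFinite {I Φ : Type*} [AddCommGroup Φ] (γ : I → Φ) : Prop :=
  ∀ φ : Φ, {m : I →₀ ℕ | monomialWeight γ m = φ}.Finite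

/-- The `k`-algebra of all sums `∑_{e ∈ E} d_e u ^ e`, where `E` is any set of monomials in the
variables `u i` of weight `γ i` (each monomial involves finitely many variables, infinitely many
variables may occur in a sum) and `d_e ∈ k`, with the usual multiplication rule.
Such a sum is the family of its coefficients `(I →₀ ℕ) → k`. The underlying `k`-algebra does not
depend on the weights `γ`, which only serve to filter it. -/
@[nolint unusedArguments]
abbrev WeightedPowerSeries (k : Type*) [Field k] {I Φ : Type*} [AddCommGroup Φ] (_γ : I → Φ) :
    Type _ :=
  MvPowerSeries I k

namespace MvPowerSeries

variable {σ k : Type*}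

section Order

variable [CommRing k] {n : ℕ∞} {f g : MvPowerSeries σ k}

/-! Power series are complete for the filtration by order (lowest total degree), even in infinitely
many variables, where it may differ from the filtration by powers of the maximal ideal. The
iteration `y ↦ y - c * f(y)` with fixed `c = f'(a₀)⁻¹` gains one order per step, so it converges to
a root. -/

theorem le_order_add_of_le (hf : n ≤ f.order) (hg : n ≤ g.order) : n ≤ (f + g).order :=
  (le_min hf hg).trans min_order_le_add

theorem le_order_sub_of_le (hf : n ≤ f.order) (hg : n ≤ g.order) : n ≤ (f - g).order := by
  rw [sub_eq_add_neg]
  exact le_order_add_of_le hf (by rwa [order_neg])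

theorem le_order_of_dvd (hf : n ≤ f.order) (h : f ∣ g) : n ≤ g.order := by
  obtain ⟨c, rfl⟩ := h
  exact (hf.trans le_self_add).trans le_order_mul

/-- A sequence of power series whose successive differences have order tending to infinity
converges, with control on the order of the remainders. -/
theorem exists_le_order_sub_of_le_order_succ_sub (x : ℕ → MvPowerSeries σ k)
    (hx : ∀ n : ℕ, ((n + 1 : ℕ) : ℕ∞) ≤ (x (n + 1) - x n).order) :
    ∃ a : MvPowerSeries σ k, ∀ n : ℕ, ((n + 1 : ℕ) : ℕ∞) ≤ (a - x n).order := by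
  have hstable : ∀ (d : σ →₀ ℕ) (m n : ℕ), d.degree ≤ m → m ≤ n →
      coeff d (x n) = coeff d (x m) := by
    intro d m n hd hmn
    induction n, hmn using Nat.le_induction with
    | base => rfl
    | succ n hmn ih =>
      rw [← ih, ← sub_eq_zero, ← map_sub]
      refine coeff_of_lt_order (lt_of_lt_of_le ?_ (hx n))
      exact_mod_cast Nat.lt_succ_of_le (hd.trans hmn)
  -- The coefficient at `d` no longer changes from index `d.degree` on.
  let a : MvPowerSeries σ k := fun d => coeff d (x d.degree)
  have ha (d : σ →₀ ℕ) : coeff d a = coeff d (x d.degree) := rfl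
  refine ⟨a, fun n => nat_le_order fun d hd => ?_⟩
  rw [map_sub, sub_eq_zero, hstable d d.degree n le_rfl (Nat.lt_succ_iff.mp hd), ha]

end Order

variable [Field k]

theorem mem_maximalIdeal_iff_one_le_order {f : MvPowerSeries σ k} :
    f ∈ IsLocalRing.maximalIdeal (MvPowerSeries σ k) ↔ 1 ≤ f.order := by
  rw [IsLocalRing.mem_maximalIdeal, mem_nonunits_iff, isUnit_iff_constantCoeff, isUnit_iff_ne_zero,
    not_not, one_le_order_iff_constCoeff_eq_zero]

/-- One step of Newton's method, with the inverse `c` of the derivative at the initial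
approximation `a₀` used in place of that at the current approximation `x`. -/
theorem succ_le_order_eval_sub_mul (f : Polynomial (MvPowerSeries σ k))
    {a₀ c x : MvPowerSeries σ k} (hc : f.derivative.eval a₀ * c = 1) (hx : 1 ≤ (x - a₀).order)
    {n : ℕ} (hn : ((n + 1 : ℕ) : ℕ∞) ≤ (f.eval x).order) :
    ((n + 2 : ℕ) : ℕ∞) ≤ (f.eval (x - c * f.eval x)).order := by
  obtain ⟨r, hr⟩ := f.binomExpansion x (-(c * f.eval x))
  obtain ⟨s, hs⟩ := Polynomial.sub_dvd_eval_sub x a₀ f.derivative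
  -- Taylor expansion with `f'(x) = f'(a₀) + (x - a₀) * s`: as `f'(a₀) * c = 1`, the term `f(x)`
  -- cancels and the cofactor left has order at least 1.
  have key : f.eval (x - c * f.eval x) =
      f.eval x * ((x - a₀) * (-(s * c)) + f.eval x * (r * c ^ 2)) := by
    rw [sub_eq_add_neg, hr]
    linear_combination (-(c * f.eval x)) * hs - f.eval x * hc
  have hn' : (1 : ℕ∞) ≤ (f.eval x).order :=
    le_trans (by exact_mod_cast Nat.succ_le_succ n.zero_le) hn
  have hr' : (1 : ℕ∞) ≤ ((x - a₀) * (-(s * c)) + f.eval x * (r * c ^ 2)).order :=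
    le_order_add_of_le (le_order_of_dvd hx (dvd_mul_right _ _))
      (le_order_of_dvd hn' (dvd_mul_right _ _))
  rw [key]
  refine le_trans ?_ ((add_le_add hn hr').trans le_order_mul)
  exact_mod_cast le_rfl

/-- Hensel's lemma for power series in an arbitrary family of variables over a field. -/
theorem henselianLocalRing : HenselianLocalRing (MvPowerSeries σ k) where
  is_henselian f _ a₀ h₀ hu := by
    obtain ⟨c, hc⟩ := hu.exists_right_inv
    rw [mem_maximalIdeal_iff_one_le_order] at h₀
    let x : ℕ → MvPowerSeries σ k := fun n => (fun y => y - c * f.eval y)^[n] a₀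
    have hsucc (n : ℕ) : x (n + 1) = x n - c * f.eval (x n) :=
      Function.iterate_succ_apply' _ _ _
    have hx (n : ℕ) : 1 ≤ (x n - a₀).order ∧ ((n + 1 : ℕ) : ℕ∞) ≤ (f.eval (x n)).order := by
      induction n with
      | zero => exact ⟨by simp [x], by simpa [x] using h₀⟩
      | succ n ih =>
        refine ⟨?_, by rw [hsucc]; exact succ_le_order_eval_sub_mul f hc ih.1 ih.2⟩
        rw [hsucc, sub_right_comm]
        refine le_order_sub_of_le ih.1 (le_order_of_dvd ?_ (dvd_mul_left _ _))
        exact le_trans (by exact_mod_cast Nat.succ_le_succ n.zero_le) ih.2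
    obtain ⟨a, ha⟩ := exists_le_order_sub_of_le_order_succ_sub x fun n => by
      rw [hsucc, sub_sub_cancel_left, order_neg]
      exact le_order_of_dvd (hx n).2 (dvd_mul_left _ _)
    refine ⟨a, ?_, ?_⟩
    -- `f(a) = (f(a) - f(x n)) + f(x n)`, and both terms have order above `n`, for every `n`.
    · rw [Polynomial.IsRoot, ← order_eq_top_iff, ENat.eq_top_iff_forall_ge]
      intro n
      have h := le_order_add_of_le
        (le_order_of_dvd (ha n) (Polynomial.sub_dvd_eval_sub a (x n) f)) (hx n).2
      rw [sub_add_cancel] at h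
      exact le_trans (by exact_mod_cast n.le_succ) h
    · rw [mem_maximalIdeal_iff_one_le_order]
      simpa [x] using ha 0

end MvPowerSeries

theorem mainTheorem11 (k : Type*) [Field k]
    {Φ : Type*} [AddCommGroup Φ] [LinearOrder Φ] [IsOrderedAddMonoid Φ]
    (Γ : AddSubmonoid Φ) (hΓ : (Γ : Set Φ).IsWF)
    {I : Type*} (γ : I → Φ) (hgen : AddSubmonoid.closure (Set.range γ) = Γ)
    (hfin : CombinatoriallyFinite γ) :
    HenselianLocalRing (WeightedPowerSeries k γ) :=
  MvPowerSeries.henselianLocalRing
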